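/- Let $d\ge 2$ be an integer, let $s$ be a real number with $d-2<s<d$, and let $\lambda\in[0,1]$. Then the integrand below is Lebesgue integrable on $[0,1]$ and $$ \int_0^1 {}_2F_1\!\left(\frac{s}{4},\frac{s+2}{4};\frac{d}{2};\frac{4r^2\lambda^2}{(\lambda^2+r^2)^2}\right) \frac{r^{d-1}}{(\lambda^2+r^2)^{s/2}\,(1-r^2)^{(d-s)/2}}\,\mathrm{d}r =\frac{\pi}{2\sin\!\left(\frac{\pi}{2}(d-s)\right)} . $$ In particular the integral does not depend on $\lambda$. Here ${}_2F_1(a,b;c;z)=\sum_{n=0}^\infty \frac{(a)_n(b)_n}{(c)_n}\frac{z^n}{n!}$ for $|z|<1$, with $(a)_n=a(a+1)\cdots(a+n-1)$ and $(a)_0=1$, is the Gauss hypergeometric function; its argument in the integral lies in $[0,1)$ for every $r\in(0,1]$ except $r=\lambda$, a null set. -/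

import Mathlib

open Real MeasureTheory

/-!
Put `u = r ^ 2`, `w = lam ^ 2`, `p = s / 2` and `δ = (d - s) / 2`, so that `0 < δ < 1` and
`d / 2 = p + δ`. Up to the factor `r ^ (d - 1) * (1 - r ^ 2) ^ (-δ)` the integrand is the radial
Riesz kernel `K(u, w) = (u + w) ^ (-p) * ₂F₁ (p / 2) ((p + 1) / 2) (p + δ) (4uw / (u + w) ^ 2)`, and
the claim is that the density `(1 - ‖x‖ ^ 2) ^ (-δ)` on the unit ball has constant Riesz potential.

The reason is that the kernel splits into products (`lintegral_kernel`):
`(uw) ^ (p + δ - 1) * B(p, δ) * K(u, w)` is the integral of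
`t ^ (p - 1) * (u - t) ^ (δ - 1) * (w - t) ^ (δ - 1)` over `0 < t < min u w`. Once this is known,
Tonelli's theorem allows integrating over `u` first, where `(u - t) ^ (δ - 1) * (1 - u) ^ (-δ)` has
the integral `B(δ, 1 - δ) = π / sin (π * δ)` over `(t, 1)`, whatever `t` is. What remains is a beta
integral over `0 < t < w`, which cancels the factor `w ^ (p + δ - 1) * B(p, δ)`.

The splitting comes from Gauss's quadratic transformation (`ordinaryHypergeometric_quadratic`)
`(1 + x) ^ (-p) * ₂F₁ (p / 2) ((p + 1) / 2) c (4x / (1 + x) ^ 2) = ₂F₁ p (p - c + 1) c x`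
at `x = min u w / max u w`, followed by Euler's integral (`lintegral_euler`). Here `c = p + δ` makes
the second parameter `1 - δ`, and this is what gives both linear factors in Euler's integral the
exponent `δ - 1`. The quadratic transformation is proved by power series for small `x` and extended
to `(0, 1)` by analytic continuation.

Everything is nonnegative, so the computation is done with Lebesgue integrals in `ℝ≥0∞`, and
integrability comes out with the value.
-/

/-! ### Rising factorials and hypergeometric series -/

theorem multichoose_eq_ascPochhammer_div (a : ℝ) (n : ℕ) :
    Ring.multichoose a n = (ascPochhammer ℝ n).eval a / n.factorial := by
  have h := Ring.factorial_nsmul_multichoose_eq_ascPochhammer a n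
  rw [Polynomial.ascPochhammer_smeval_eq_eval, nsmul_eq_mul] at h
  rw [← h]
  field_simp

theorem hasSum_one_sub_rpow_neg (a : ℝ) {x : ℝ} (hx : |x| < 1) :
    HasSum (fun n : ℕ => (ascPochhammer ℝ n).eval a / n.factorial * x ^ n) ((1 - x) ^ (-a)) := by
  have h := (Real.one_div_one_sub_rpow_hasFPowerSeriesOnBall_zero a).hasSum (y := x)
    (by simpa [enorm_eq_nnnorm] using! hx)
  have hx' : 0 ≤ 1 - x := by linarith [(abs_lt.1 hx).2]
  simp only [zero_add, one_div, ← Real.rpow_neg hx',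
    FormalMultilinearSeries.ofScalars_apply_eq, smul_eq_mul] at h
  simpa only [← Ring.multichoose_eq, multichoose_eq_ascPochhammer_div] using h

theorem ascPochhammer_eval_add (a : ℝ) (m n : ℕ) :
    (ascPochhammer ℝ (m + n)).eval a =
      (ascPochhammer ℝ m).eval a * (ascPochhammer ℝ n).eval (a + m) := by
  rw [← ascPochhammer_mul]
  simp

/-- A form of the Chu–Vandermonde identity. It is `Ring.add_choose_eq` for the sum
`-(p + m) + (c + m - 1) = -(p - c + 1)`, rewritten in terms of rising factorials. -/
theorem sum_antidiagonal_ascPochhammer (p : ℝ) {c : ℝ} (hc : 0 < c) (m : ℕ) :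
    ∑ ij ∈ Finset.HasAntidiagonal.antidiagonal m, (-1) ^ ij.2 * (ascPochhammer ℝ ij.1).eval (p + m) /
      ((ascPochhammer ℝ ij.1).eval c * ij.1.factorial * ij.2.factorial) =
    (ascPochhammer ℝ m).eval (p - c + 1) / ((ascPochhammer ℝ m).eval c * m.factorial) := by
  have key := Ring.add_choose_eq m (Commute.all (-(p + m)) (c + m - 1))
  have e : -(p + m) + (c + m - 1) = -(p - c + 1) := by ring
  rw [e, Ring.choose_neg, ← Ring.multichoose_eq, multichoose_eq_ascPochhammer_div] at key
  have hsq : ((-1 : ℝ) ^ m) * (-1) ^ m = 1 := by rw [← mul_pow]; simp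
  have key' : (ascPochhammer ℝ m).eval (p - c + 1) / m.factorial =
      (-1) ^ m * ∑ ij ∈ Finset.HasAntidiagonal.antidiagonal m,
        Ring.choose (-(p + m)) ij.1 * Ring.choose (c + m - 1) ij.2 := by
    rw [← key, Units.smul_def]
    simp [Int.negOnePow_def, ← mul_assoc]
    rw [hsq, one_mul]
  have hcm := ascPochhammer_pos m c hc
  rw [mul_comm, ← div_div, key', Finset.mul_sum, Finset.sum_div]
  refine Finset.sum_congr rfl fun ij hij => ?_
  rw [Finset.HasAntidiagonal.mem_antidiagonal] at hij
  obtain ⟨i, j⟩ := ij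
  subst hij
  have h1 : Ring.choose (-(p + (i + j : ℕ))) i =
      (-1) ^ i * ((ascPochhammer ℝ i).eval (p + (i + j : ℕ)) / i.factorial) := by
    rw [Ring.choose_neg, ← Ring.multichoose_eq, multichoose_eq_ascPochhammer_div, Units.smul_def]
    simp [Int.negOnePow_def]
  have h2 : Ring.choose (c + (i + j : ℕ) - 1) j =
      (ascPochhammer ℝ j).eval (c + i) / j.factorial := by
    rw [← multichoose_eq_ascPochhammer_div, Ring.multichoose_eq]
    push_cast
    ring_nf
  have hi : (-1 : ℝ) ^ (i + j) * (-1) ^ i = (-1) ^ j := by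
    rw [pow_add, mul_right_comm, ← mul_pow]; simp
  have hci := (ascPochhammer_pos i c hc).ne'
  have hcj := (ascPochhammer_pos j (c + i) (by positivity)).ne'
  rw [h1, h2, ascPochhammer_eval_add c i j, ← hi]
  field_simp

theorem hasSum_ordinaryHypergeometric {a b c : ℝ} (ha : 0 < a) (hb : 0 < b) (hc : 0 < c) {x : ℝ}
    (hx : |x| < 1) :
    HasSum (fun n : ℕ => (ascPochhammer ℝ n).eval a * (ascPochhammer ℝ n).eval b /
      ((ascPochhammer ℝ n).eval c * n.factorial) * x ^ n) (₂F₁ a b c x) := by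
  have hr := ordinaryHypergeometricSeries_radius_eq_one ℝ a b c fun k =>
    ⟨by linarith [(Nat.cast_nonneg k : (0 : ℝ) ≤ k)],
      by linarith [(Nat.cast_nonneg k : (0 : ℝ) ≤ k)],
      by linarith [(Nat.cast_nonneg k : (0 : ℝ) ≤ k)]⟩
  have h := (ordinaryHypergeometricSeries ℝ a b c).hasSum (x := x)
    (by rw [hr]; simpa [enorm_eq_nnnorm] using! hx)
  simp only [ordinaryHypergeometricSeries_apply_eq, smul_eq_mul] at h
  have hcoeff (n : ℕ) : (n.factorial : ℝ)⁻¹ * (ascPochhammer ℝ n).eval a *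
      (ascPochhammer ℝ n).eval b * ((ascPochhammer ℝ n).eval c)⁻¹ =
      (ascPochhammer ℝ n).eval a * (ascPochhammer ℝ n).eval b /
        ((ascPochhammer ℝ n).eval c * n.factorial) := by
    rw [div_eq_mul_inv, mul_inv]
    ring
  simpa only [hcoeff] using! h

theorem analyticOnNhd_ordinaryHypergeometric {a b c : ℝ} (ha : 0 < a) (hb : 0 < b) (hc : 0 < c) :
    AnalyticOnNhd ℝ (₂F₁ a b c : ℝ → ℝ) (Set.Ioo (-1) 1) := by
  have hr := ordinaryHypergeometricSeries_radius_eq_one ℝ a b c fun k =>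
    ⟨by linarith [(Nat.cast_nonneg k : (0 : ℝ) ≤ k)],
      by linarith [(Nat.cast_nonneg k : (0 : ℝ) ≤ k)],
      by linarith [(Nat.cast_nonneg k : (0 : ℝ) ≤ k)]⟩
  have h := ((ordinaryHypergeometricSeries ℝ a b c).hasFPowerSeriesOnBall
    (by rw [hr]; exact one_pos)).analyticOnNhd
  rw [hr] at h
  refine h.mono fun x hx => ?_
  have : |x| < 1 := abs_lt.2 hx
  simpa [enorm_eq_nnnorm] using! this

/-- The duplication formula `(p / 2)_n ((p + 1) / 2)_n 4 ^ n = (p)_{2n}`. -/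
theorem ascPochhammer_half_mul (p : ℝ) (n : ℕ) :
    (ascPochhammer ℝ n).eval (p / 2) * (ascPochhammer ℝ n).eval ((p + 1) / 2) * 4 ^ n =
      (ascPochhammer ℝ (2 * n)).eval p := by
  induction n with
  | zero => simp
  | succ n ih =>
    simp only [show 2 * (n + 1) = 2 * n + 1 + 1 by ring, ascPochhammer_succ_eval, ← ih]
    push_cast
    ring

/-! ### The quadratic transformation -/

/-- The double series behind the quadratic transformation, with all terms made positive. Its sum is
`(1 - x) ^ (-p) * ₂F₁ (p / 2) ((p + 1) / 2) c (4 * x / (1 - x) ^ 2)`, and `x < 1 / 6` keeps the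
argument below `1`. -/
theorem summable_quadratic_double_series {p c x : ℝ} (hp : 0 < p) (hc : 0 < c) (hx : 0 < x)
    (hx' : x < 1 / 6) :
    Summable fun nk : ℕ × ℕ => (ascPochhammer ℝ (2 * nk.1)).eval p /
      ((ascPochhammer ℝ nk.1).eval c * nk.1.factorial) * x ^ nk.1 *
        ((ascPochhammer ℝ nk.2).eval (p + (2 * nk.1 : ℕ)) / nk.2.factorial * x ^ nk.2) := by
  have hrow (n : ℕ) := hasSum_one_sub_rpow_neg (p + (2 * n : ℕ)) (x := x)
    (by rw [abs_lt]; constructor <;> linarith)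
  have h1x : 0 < 1 - x := by linarith
  refine (summable_prod_of_nonneg ?_).2 ⟨fun n => ?_, ?_⟩
  · intro nk
    have := ascPochhammer_pos (2 * nk.1) p hp
    have := ascPochhammer_pos nk.1 c hc
    have := ascPochhammer_pos nk.2 (p + (2 * nk.1 : ℕ)) (by positivity)
    simp only [Pi.zero_apply]
    positivity
  · simpa only using (hrow n).summable.mul_left _
  · simp only [tsum_mul_left, (hrow _).tsum_eq]
    have hz : |4 * x / (1 - x) ^ 2| < 1 := by
      rw [abs_of_pos (by positivity), div_lt_one (by positivity)]
      nlinarith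
    have h := (hasSum_ordinaryHypergeometric (a := p / 2) (b := (p + 1) / 2) (by positivity)
      (by positivity) hc hz).summable.mul_left ((1 - x) ^ (-p))
    refine h.congr fun n => ?_
    rw [← ascPochhammer_half_mul, neg_add, Real.rpow_add h1x, Real.rpow_neg h1x.le ((2 * n : ℕ) : ℝ),
      Real.rpow_natCast, div_pow, mul_pow, ← pow_mul]
    field_simp

/-- The quadratic transformation for small `x`. Expanding `(1 + x) ^ (-(p + 2 * n))` by the binomial
series turns the left side into an absolutely convergent double series, and the coefficient of
`x ^ m` is evaluated by the Chu–Vandermonde identity. -/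
theorem ordinaryHypergeometric_quadratic_of_small {p c x : ℝ} (hp : 0 < p) (hc : 0 < c)
    (hpc : 0 < p - c + 1) (hx : 0 < x) (hx' : x < 1 / 6) :
    (1 + x) ^ (-p) * ₂F₁ (p / 2) ((p + 1) / 2) c (4 * x / (1 + x) ^ 2) =
      ₂F₁ p (p - c + 1) c x := by
  have h1x : 0 < 1 + x := by linarith
  have hz : |4 * x / (1 + x) ^ 2| < 1 := by
    rw [abs_of_pos (by positivity), div_lt_one (by positivity)]
    nlinarith
  set f : ℕ × ℕ → ℝ := fun nk => (ascPochhammer ℝ (2 * nk.1)).eval p /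
      ((ascPochhammer ℝ nk.1).eval c * nk.1.factorial) * x ^ nk.1 *
        ((ascPochhammer ℝ nk.2).eval (p + (2 * nk.1 : ℕ)) / nk.2.factorial * (-x) ^ nk.2) with hf
  have hsum : Summable f := by
    refine Summable.of_abs ((summable_quadratic_double_series hp hc hx hx').congr fun nk => ?_)
    have h1 := ascPochhammer_pos (2 * nk.1) p hp
    have h2 := ascPochhammer_pos nk.1 c hc
    have h3 := ascPochhammer_pos nk.2 (p + (2 * nk.1 : ℕ)) (by positivity)
    simp only [hf, abs_mul, abs_div, abs_pow, abs_neg, abs_of_pos hx, abs_of_pos h1, abs_of_pos h2,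
      abs_of_pos h3, Nat.abs_cast]
  have hrows : ∑' nk, f nk =
      (1 + x) ^ (-p) * ₂F₁ (p / 2) ((p + 1) / 2) c (4 * x / (1 + x) ^ 2) := by
    have hrow (n : ℕ) := hasSum_one_sub_rpow_neg (p + (2 * n : ℕ)) (x := -x)
      (by rw [abs_lt]; constructor <;> linarith)
    rw [hsum.tsum_prod, ← (hasSum_ordinaryHypergeometric (a := p / 2) (b := (p + 1) / 2)
      (by positivity) (by positivity) hc hz).tsum_eq, ← tsum_mul_left]
    refine tsum_congr fun n => ?_
    simp only [hf]
    rw [tsum_mul_left, (hrow n).tsum_eq, sub_neg_eq_add,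
      ← ascPochhammer_half_mul, neg_add, Real.rpow_add h1x, Real.rpow_neg h1x.le ((2 * n : ℕ) : ℝ),
      Real.rpow_natCast, div_pow, mul_pow, ← pow_mul]
    field_simp
  have hdiag : ∑' nk, f nk = ₂F₁ p (p - c + 1) c x := by
    rw [← (hasSum_ordinaryHypergeometric hp hpc hc (x := x)
      (by rw [abs_lt]; constructor <;> linarith)).tsum_eq,
      ← Finset.HasAntidiagonal.sigmaAntidiagonalEquivProd.tsum_eq f]
    refine (Summable.tsum_sigma' (f := f ∘ Finset.HasAntidiagonal.sigmaAntidiagonalEquivProd)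
      (fun _ => Summable.of_finite)
      (Finset.HasAntidiagonal.sigmaAntidiagonalEquivProd.summable_iff.2 hsum)).trans
      (tsum_congr fun m => ?_)
    rw [tsum_fintype, mul_div_assoc, ← sum_antidiagonal_ascPochhammer p hc m, Finset.mul_sum,
      Finset.sum_mul, ← Finset.sum_coe_sort (Finset.HasAntidiagonal.antidiagonal m)]
    refine Finset.sum_congr rfl ?_
    rintro ⟨⟨i, j⟩, hij⟩ -
    rw [Finset.HasAntidiagonal.mem_antidiagonal] at hij
    simp only at hij
    subst hij
    have h1 : (ascPochhammer ℝ (2 * i)).eval p * (ascPochhammer ℝ j).eval (p + (2 * i : ℕ)) =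
        (ascPochhammer ℝ (i + j)).eval p * (ascPochhammer ℝ i).eval (p + (i + j : ℕ)) := by
      rw [← ascPochhammer_eval_add, ← ascPochhammer_eval_add]
      congr 2
      ring
    simp only [hf, Function.comp_apply,
      Finset.HasAntidiagonal.sigmaAntidiagonalEquivProd_apply]
    rw [neg_pow, pow_add]
    linear_combination (x ^ i * (-1) ^ j * x ^ j / ((ascPochhammer ℝ i).eval c * i.factorial *
      j.factorial)) * h1
  rw [← hrows, hdiag]

/-- The quadratic transformation of the hypergeometric function on all of `(0, 1)`, by analytic
continuation: the double series need not converge absolutely for larger `x`. -/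
theorem ordinaryHypergeometric_quadratic {p c x : ℝ} (hp : 0 < p) (hc : 0 < c)
    (hpc : 0 < p - c + 1) (hx : 0 < x) (hx' : x < 1) :
    (1 + x) ^ (-p) * ₂F₁ (p / 2) ((p + 1) / 2) c (4 * x / (1 + x) ^ 2) =
      ₂F₁ p (p - c + 1) c x := by
  have hleft : AnalyticOnNhd ℝ
      (fun x : ℝ => (1 + x) ^ (-p) * ₂F₁ (p / 2) ((p + 1) / 2) c (4 * x / (1 + x) ^ 2))
      (Set.Ioo 0 1) := by
    intro y hy
    have h1y : 0 < 1 + y := by linarith [hy.1]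
    have hz : 4 * y / (1 + y) ^ 2 ∈ Set.Ioo (-1 : ℝ) 1 := by
      have := hy.1
      constructor
      · linarith [show 0 < 4 * y / (1 + y) ^ 2 by positivity]
      · rw [div_lt_one (by positivity)]
        nlinarith [sq_pos_of_pos (sub_pos.2 hy.2)]
    have hF := analyticOnNhd_ordinaryHypergeometric (a := p / 2) (b := (p + 1) / 2)
      (by positivity) (by positivity) hc _ hz
    have hadd : AnalyticAt ℝ (fun x : ℝ => 1 + x) y := by fun_prop
    have hpow : AnalyticAt ℝ (fun x : ℝ => (1 + x) ^ (-p)) y := by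
      refine ((hadd.log h1y).fun_mul (analyticAt_const (v := -p))).rexp'.congr ?_
      filter_upwards [lt_mem_nhds hy.1] with x hx
      exact (Real.rpow_def_of_pos (by linarith) _).symm
    refine hpow.mul ?_
    refine AnalyticAt.fun_comp (f := fun x : ℝ => 4 * x / (1 + x) ^ 2) hF ?_
    refine AnalyticAt.div (by fun_prop) (by fun_prop) (by positivity)
  have hright : AnalyticOnNhd ℝ (₂F₁ p (p - c + 1) c : ℝ → ℝ) (Set.Ioo 0 1) :=
    (analyticOnNhd_ordinaryHypergeometric hp hpc hc).mono (Set.Ioo_subset_Ioo_left (by norm_num))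
  refine hleft.eqOn_of_preconnected_of_eventuallyEq hright isPreconnected_Ioo
    (z₀ := 1 / 12) (by norm_num) ?_ ⟨hx, hx'⟩
  filter_upwards [Ioo_mem_nhds (show (0 : ℝ) < 1 / 12 by norm_num)
    (show (1 / 12 : ℝ) < 1 / 6 by norm_num)] with y hy
  exact ordinaryHypergeometric_quadratic_of_small hp hc hpc hy.1 hy.2

/-! ### Beta integrals -/

theorem lintegral_Ioo_eq_lintegral_unit {a b : ℝ} (hab : a < b) (g : ℝ → ENNReal) :
    ∫⁻ x in Set.Ioo a b, g x =
      ∫⁻ v in Set.Ioo (0 : ℝ) 1, ENNReal.ofReal (b - a) * g (a + (b - a) * v) := by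
  have hba : 0 < b - a := sub_pos.2 hab
  have himg : (fun v : ℝ => a + (b - a) * v) '' Set.Ioo 0 1 = Set.Ioo a b := by
    ext y
    constructor
    · rintro ⟨v, hv, rfl⟩
      constructor <;> nlinarith [hv.1, hv.2]
    · intro hy
      refine ⟨(y - a) / (b - a), ⟨div_pos (sub_pos.2 hy.1) hba, ?_⟩, ?_⟩
      · rw [div_lt_one hba]
        linarith [hy.2]
      · field_simp
        ring
  have hderiv (v : ℝ) : HasDerivAt (fun v : ℝ => a + (b - a) * v) (b - a) v := by
    simpa using ((hasDerivAt_id v).const_mul (b - a)).const_add a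
  rw [← himg, lintegral_image_eq_lintegral_abs_deriv_mul measurableSet_Ioo
    (fun v _ => (hderiv v).hasDerivWithinAt)
    (fun v _ w _ h => mul_left_cancel₀ hba.ne' (add_left_cancel h)), abs_of_pos hba]

theorem lintegral_rpow_mul_one_sub_rpow {a b : ℝ} (ha : 0 < a) (hb : 0 < b) :
    ∫⁻ x in Set.Ioo (0 : ℝ) 1, ENNReal.ofReal (x ^ (a - 1) * (1 - x) ^ (b - 1)) =
      ENNReal.ofReal (ProbabilityTheory.beta a b) := by
  have hB := ProbabilityTheory.beta_pos ha hb
  have h := ProbabilityTheory.lintegral_betaPDF_eq_one ha hb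
  simp only [ProbabilityTheory.lintegral_betaPDF, mul_assoc] at h
  simp only [ENNReal.ofReal_mul (one_div_pos.2 hB).le] at h
  rw [lintegral_const_mul' _ _ ENNReal.ofReal_ne_top, one_div, ENNReal.ofReal_inv_of_pos hB] at h
  rw [mul_comm] at h
  rw [ENNReal.eq_inv_of_mul_eq_one_left h, inv_inv]

theorem lintegral_sub_rpow_mul_sub_rpow {a b x y : ℝ} (ha : 0 < a) (hb : 0 < b) (hxy : x < y) :
    ∫⁻ t in Set.Ioo x y, ENNReal.ofReal ((t - x) ^ (a - 1) * (y - t) ^ (b - 1)) =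
      ENNReal.ofReal ((y - x) ^ (a + b - 1) * ProbabilityTheory.beta a b) := by
  have h : 0 < y - x := sub_pos.2 hxy
  rw [lintegral_Ioo_eq_lintegral_unit hxy, ENNReal.ofReal_mul (by positivity),
    ← lintegral_rpow_mul_one_sub_rpow ha hb, ← lintegral_const_mul' _ _ ENNReal.ofReal_ne_top]
  refine setLIntegral_congr_fun measurableSet_Ioo fun v hv => ?_
  have hv1 : 0 < 1 - v := sub_pos.2 hv.2
  have hv0 := hv.1
  rw [← ENNReal.ofReal_mul h.le, ← ENNReal.ofReal_mul (by positivity)]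
  congr 1
  rw [add_sub_cancel_left, show y - (x + (y - x) * v) = (y - x) * (1 - v) by ring,
    Real.mul_rpow h.le hv.1.le, Real.mul_rpow h.le hv1.le,
    show a + b - 1 = 1 + (a - 1) + (b - 1) by ring, Real.rpow_add h, Real.rpow_add h, Real.rpow_one]
  ring

theorem beta_add_natCast {p δ : ℝ} (hp : 0 < p) (hδ : 0 < δ) (n : ℕ) :
    ProbabilityTheory.beta (p + n) δ = ProbabilityTheory.beta p δ *
      ((ascPochhammer ℝ n).eval p / (ascPochhammer ℝ n).eval (p + δ)) := by
  induction n with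
  | zero => simp
  | succ n ih =>
    have h1 : p + n ≠ 0 := by positivity
    have h2 : p + n + δ ≠ 0 := by positivity
    have h3 := (ascPochhammer_pos n (p + δ) (by positivity)).ne'
    have h4 := (Real.Gamma_pos_of_pos (show 0 < p + n + δ by positivity)).ne'
    have key : ProbabilityTheory.beta (p + (n + 1 : ℕ)) δ =
        ProbabilityTheory.beta (p + n) δ * ((p + n) / (p + n + δ)) := by
      unfold ProbabilityTheory.beta
      rw [Nat.cast_succ, ← add_assoc, Real.Gamma_add_one h1,
        show p + n + 1 + δ = p + n + δ + 1 by ring, Real.Gamma_add_one h2]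
      field_simp
    rw [key, ih, ascPochhammer_succ_eval, ascPochhammer_succ_eval,
      show p + δ + n = p + n + δ by ring]
    field_simp

/-! ### Euler's integral and the radial Riesz kernel -/

/-- Euler's integral for `₂F₁ p (1 - δ) (p + δ)`, with the parameter `p` as the one represented by
the integral. This choice gives `1 - v` and `1 - x * v` the same exponent. -/
theorem lintegral_euler {p δ x : ℝ} (hp : 0 < p) (hδ : 0 < δ) (hδ' : δ < 1) (hx : 0 < x)
    (hx' : x < 1) :
    ∫⁻ v in Set.Ioo (0 : ℝ) 1,
        ENNReal.ofReal (v ^ (p - 1) * (1 - v) ^ (δ - 1) * (1 - x * v) ^ (δ - 1)) =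
      ENNReal.ofReal (ProbabilityTheory.beta p δ * ₂F₁ p (1 - δ) (p + δ) x) := by
  have hδ1 : 0 < 1 - δ := sub_pos.2 hδ'
  have hB := ProbabilityTheory.beta_pos hp hδ
  have hF := (hasSum_ordinaryHypergeometric hp hδ1 (add_pos hp hδ) (x := x)
    (by rw [abs_lt]; constructor <;> linarith)).mul_left (ProbabilityTheory.beta p δ)
  have hpos (a : ℝ) (ha : 0 < a) (n : ℕ) := ascPochhammer_pos n a ha
  have hcoef (n : ℕ) : 0 < (ascPochhammer ℝ n).eval (1 - δ) / n.factorial * x ^ n := by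
    have := hpos _ hδ1 n
    positivity
  have hexp : ∀ v ∈ Set.Ioo (0 : ℝ) 1,
      ENNReal.ofReal (v ^ (p - 1) * (1 - v) ^ (δ - 1) * (1 - x * v) ^ (δ - 1)) =
      ∑' n : ℕ, ENNReal.ofReal ((ascPochhammer ℝ n).eval (1 - δ) / n.factorial * x ^ n) *
        ENNReal.ofReal (v ^ (p + n - 1) * (1 - v) ^ (δ - 1)) := by
    intro v hv
    have hv1 : 0 < 1 - v := sub_pos.2 hv.2
    have hv0 := hv.1
    have hxv : |x * v| < 1 := by
      rw [abs_of_pos (by positivity)]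
      nlinarith
    have hs := (hasSum_one_sub_rpow_neg (1 - δ) hxv).mul_left (v ^ (p - 1) * (1 - v) ^ (δ - 1))
    rw [neg_sub] at hs
    rw [← hs.tsum_eq, ENNReal.ofReal_tsum_of_nonneg _ hs.summable]
    · refine tsum_congr fun n => ?_
      rw [← ENNReal.ofReal_mul (hcoef n).le, mul_pow, show p + n - 1 = p - 1 + n by ring,
        Real.rpow_add_natCast hv0.ne']
      congr 1
      ring
    · intro n
      have := hpos _ hδ1 n
      positivity
  rw [setLIntegral_congr_fun measurableSet_Ioo hexp, lintegral_tsum (fun n => by fun_prop),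
    ← hF.tsum_eq, ENNReal.ofReal_tsum_of_nonneg _ hF.summable]
  · refine tsum_congr fun n => ?_
    rw [lintegral_const_mul' _ _ ENNReal.ofReal_ne_top,
      lintegral_rpow_mul_one_sub_rpow (by positivity) hδ, ← ENNReal.ofReal_mul (hcoef n).le,
      beta_add_natCast hp hδ]
    congr 1
    rw [← div_div]
    ring
  · intro n
    have := hpos _ hδ1 n
    have := hpos _ hp n
    have := hpos _ (add_pos hp hδ) n
    positivity

/-- The radial Riesz kernel in squared radii: if `c = n / 2`, `u = ‖x‖ ^ 2` and `w = ‖y‖ ^ 2` for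
`x, y ∈ ℝⁿ`, this is the mean of `‖x - y‖ ^ (-2 * p)` over all rotations of `x`. It is a genuine
value for `u ≠ w`; at `u = w` the argument of the hypergeometric function is `1`, outside the open
disc of convergence. -/
noncomputable def rieszKernel (p c u w : ℝ) : ℝ :=
  ₂F₁ (p / 2) ((p + 1) / 2) c (4 * u * w / (w + u) ^ 2) * (w + u) ^ (-p)

theorem rieszKernel_comm (p c u w : ℝ) : rieszKernel p c u w = rieszKernel p c w u := by
  unfold rieszKernel
  rw [mul_right_comm, add_comm w u]

theorem rieszKernel_nonneg {p c u w : ℝ} (hp : 0 < p) (hc : 0 < c) (hu : 0 < u) (hw : 0 ≤ w)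
    (huw : u ≠ w) : 0 ≤ rieszKernel p c u w := by
  have hwu : 0 < w + u := by linarith
  have hz : |4 * u * w / (w + u) ^ 2| < 1 := by
    rw [abs_of_nonneg (by positivity), div_lt_one (by positivity)]
    nlinarith [sq_pos_of_ne_zero (sub_ne_zero.2 huw)]
  have h := hasSum_ordinaryHypergeometric (a := p / 2) (b := (p + 1) / 2) (by positivity)
    (by positivity) hc hz
  refine mul_nonneg (h.nonneg fun n => ?_) (by positivity)
  have := ascPochhammer_pos n (p / 2) (by positivity)
  have := ascPochhammer_pos n ((p + 1) / 2) (by positivity)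
  have := ascPochhammer_pos n c hc
  positivity

/-- The substitution `t = u * v` in Euler's integral, combined with the quadratic transformation at
`x = u / w`. -/
theorem lintegral_kernel_of_lt {p δ u w : ℝ} (hp : 0 < p) (hδ : 0 < δ) (hδ' : δ < 1)
    (hu : 0 < u) (huw : u < w) :
    ∫⁻ t in Set.Ioo 0 u, ENNReal.ofReal (t ^ (p - 1) * (u - t) ^ (δ - 1) * (w - t) ^ (δ - 1)) =
      ENNReal.ofReal ((u * w) ^ (p + δ - 1) * ProbabilityTheory.beta p δ *
        rieszKernel p (p + δ) u w) := by
  have hw : 0 < w := hu.trans huw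
  have hx : 0 < u / w := by positivity
  have hx' : u / w < 1 := (div_lt_one hw).2 huw
  have hquad := ordinaryHypergeometric_quadratic (c := p + δ) hp (by positivity) (by linarith) hx hx'
  have hz : 4 * (u / w) / (1 + u / w) ^ 2 = 4 * u * w / (w + u) ^ 2 := by
    field_simp
  have h1 : 1 + u / w = (w + u) / w := by field_simp
  have hK : w ^ p * rieszKernel p (p + δ) u w = ₂F₁ p (1 - δ) (p + δ) (u / w) := by
    rw [show 1 - δ = p - (p + δ) + 1 by ring, ← hquad, hz, h1,
      Real.div_rpow (by positivity) hw.le, Real.rpow_neg hw.le, rieszKernel, div_inv_eq_mul]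
    ring
  have hscale : (u * w) ^ (p + δ - 1) * ProbabilityTheory.beta p δ * rieszKernel p (p + δ) u w =
      u ^ (p + δ - 1) * w ^ (δ - 1) *
        (ProbabilityTheory.beta p δ * ₂F₁ p (1 - δ) (p + δ) (u / w)) := by
    rw [← hK, Real.mul_rpow hu.le hw.le, show p + δ - 1 = p + (δ - 1) by ring, Real.rpow_add hw]
    ring
  rw [hscale, ENNReal.ofReal_mul (by positivity), ← lintegral_euler hp hδ hδ' hx hx',
    lintegral_Ioo_eq_lintegral_unit hu, ← lintegral_const_mul' _ _ ENNReal.ofReal_ne_top]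
  refine setLIntegral_congr_fun measurableSet_Ioo fun v hv => ?_
  have hv1 : 0 < 1 - v := sub_pos.2 hv.2
  have hxv : 0 ≤ 1 - u / w * v := by nlinarith [hv.1, hv.2]
  simp only [sub_zero, zero_add]
  rw [← ENNReal.ofReal_mul hu.le, ← ENNReal.ofReal_mul (by positivity)]
  congr 1
  rw [show u - u * v = u * (1 - v) by ring, show w - u * v = w * (1 - u / w * v) by field_simp,
    Real.mul_rpow hu.le hv.1.le, Real.mul_rpow hu.le hv1.le, Real.mul_rpow hw.le hxv,
    show p + δ - 1 = 1 + (p - 1) + (δ - 1) by ring, Real.rpow_add hu, Real.rpow_add hu,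
    Real.rpow_one]
  ring

/-- The kernel as a superposition of products: each factor of the integrand depends on `t` and at
most one of `u` and `w`. -/
theorem lintegral_kernel {p δ u w : ℝ} (hp : 0 < p) (hδ : 0 < δ) (hδ' : δ < 1)
    (hu : 0 < u) (hw : 0 < w) (huw : u ≠ w) :
    ∫⁻ t in Set.Ioo 0 (min u w),
        ENNReal.ofReal (t ^ (p - 1) * (u - t) ^ (δ - 1) * (w - t) ^ (δ - 1)) =
      ENNReal.ofReal ((u * w) ^ (p + δ - 1) * ProbabilityTheory.beta p δ *
        rieszKernel p (p + δ) u w) := by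
  rcases huw.lt_or_gt with h | h
  · rw [min_eq_left h.le, lintegral_kernel_of_lt hp hδ hδ' hu h]
  · rw [min_eq_right h.le, mul_comm u w, rieszKernel_comm,
      ← lintegral_kernel_of_lt hp hδ hδ' hw h]
    simp only [mul_right_comm]

/-! ### Integration of the kernel against the equilibrium density -/

theorem integrable_and_integral_eq_of_lintegral_ofReal {α : Type*} [MeasurableSpace α]
    {μ : Measure α} {f : α → ℝ} {I : ℝ} (hf : 0 ≤ᵐ[μ] f) (hfm : AEStronglyMeasurable f μ)
    (hI : 0 ≤ I) (hint : ∫⁻ x, ENNReal.ofReal (f x) ∂μ = ENNReal.ofReal I) :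
    Integrable f μ ∧ ∫ x, f x ∂μ = I := by
  refine ⟨⟨hfm, ?_⟩, ?_⟩
  · rw [hasFiniteIntegral_iff_ofReal hf, hint]
    exact ENNReal.ofReal_lt_top
  · rw [integral_eq_lintegral_of_nonneg_ae hf hfm, hint, ENNReal.toReal_ofReal hI]

theorem beta_one_sub (δ : ℝ) :
    ProbabilityTheory.beta δ (1 - δ) = π / Real.sin (π * δ) := by
  rw [ProbabilityTheory.beta, add_sub_cancel, Real.Gamma_one, div_one,
    Real.Gamma_mul_Gamma_one_sub]

/-- By Tonelli's theorem the integral over `u` comes first: over `(t, 1)` it is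
`beta δ (1 - δ)` for every `t`, so only a beta integral over `(0, w)` remains. -/
theorem lintegral_lintegral_kernel {p δ w : ℝ} (hp : 0 < p) (hδ : 0 < δ) (hδ' : δ < 1)
    (hw : 0 < w) (hw' : w ≤ 1) :
    ∫⁻ u in Set.Ioo (0 : ℝ) 1, ENNReal.ofReal ((1 - u) ^ (-δ)) *
        ∫⁻ t in Set.Ioo 0 (min u w),
          ENNReal.ofReal (t ^ (p - 1) * (u - t) ^ (δ - 1) * (w - t) ^ (δ - 1)) =
      ENNReal.ofReal (ProbabilityTheory.beta δ (1 - δ) *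
        (w ^ (p + δ - 1) * ProbabilityTheory.beta p δ)) := by
  -- The region of integration over pairs `(u, t)`.
  set T : Set (ℝ × ℝ) := {q | 0 < q.2 ∧ q.2 < q.1 ∧ q.1 < 1 ∧ q.2 < w} with hT
  have hTm : MeasurableSet T := by
    rw [hT]
    measurability
  set g : ℝ × ℝ → ENNReal := T.indicator fun q =>
    ENNReal.ofReal (q.2 ^ (p - 1) * (w - q.2) ^ (δ - 1)) *
      ENNReal.ofReal ((q.1 - q.2) ^ (δ - 1) * (1 - q.1) ^ (1 - δ - 1)) with hg
  have hgm : Measurable g := by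
    refine Measurable.indicator ?_ hTm
    fun_prop
  have hL : ∫⁻ u in Set.Ioo (0 : ℝ) 1, ENNReal.ofReal ((1 - u) ^ (-δ)) *
        ∫⁻ t in Set.Ioo 0 (min u w),
          ENNReal.ofReal (t ^ (p - 1) * (u - t) ^ (δ - 1) * (w - t) ^ (δ - 1)) =
      ∫⁻ u, ∫⁻ t, g (u, t) := by
    rw [← lintegral_indicator measurableSet_Ioo]
    refine lintegral_congr fun u => ?_
    by_cases hu : u ∈ Set.Ioo (0 : ℝ) 1
    · rw [Set.indicator_of_mem hu, ← lintegral_const_mul' _ _ ENNReal.ofReal_ne_top,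
        ← lintegral_indicator measurableSet_Ioo]
      refine lintegral_congr fun t => ?_
      by_cases ht : t ∈ Set.Ioo 0 (min u w)
      · have htu := lt_min_iff.1 ht.2
        have ht0 := ht.1
        have h1 : 0 < u - t := sub_pos.2 htu.1
        have h2 : 0 < w - t := sub_pos.2 htu.2
        have h3 : 0 < 1 - u := sub_pos.2 hu.2
        rw [Set.indicator_of_mem ht, hg,
          Set.indicator_of_mem (show (u, t) ∈ T from ⟨ht.1, htu.1, hu.2, htu.2⟩),
          ← ENNReal.ofReal_mul (by positivity), ← ENNReal.ofReal_mul (by positivity),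
          show 1 - δ - 1 = -δ by ring]
        congr 1
        ring
      · rw [Set.indicator_of_notMem ht, hg, Set.indicator_of_notMem]
        exact fun h => ht ⟨h.1, lt_min_iff.2 ⟨h.2.1, h.2.2.2⟩⟩
    · rw [Set.indicator_of_notMem hu]
      refine (lintegral_eq_zero_of_ae_eq_zero (.of_forall fun t => ?_)).symm
      exact Set.indicator_of_notMem (fun h => hu ⟨h.1.trans h.2.1, h.2.2.1⟩) _
  have hR : ∀ t : ℝ, ∫⁻ u, g (u, t) = (Set.Ioo 0 w).indicator (fun t =>
      ENNReal.ofReal (ProbabilityTheory.beta δ (1 - δ)) *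
        ENNReal.ofReal ((t - 0) ^ (p - 1) * (w - t) ^ (δ - 1))) t := by
    intro t
    by_cases ht : t ∈ Set.Ioo 0 w
    · have ht1 : t < 1 := ht.2.trans_le hw'
      -- The exponents `δ` and `1 - δ` add up to `1`, so the length `1 - t` has exponent `0`.
      have hbeta := lintegral_sub_rpow_mul_sub_rpow hδ (sub_pos.2 hδ') ht1
      rw [show δ + (1 - δ) - 1 = 0 by ring, Real.rpow_zero, one_mul] at hbeta
      rw [Set.indicator_of_mem ht, ← hbeta, mul_comm, sub_zero,
        ← lintegral_const_mul' _ _ ENNReal.ofReal_ne_top, ← lintegral_indicator measurableSet_Ioo]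
      refine lintegral_congr fun u => ?_
      by_cases hu : u ∈ Set.Ioo t 1
      · rw [Set.indicator_of_mem hu, hg,
          Set.indicator_of_mem (show (u, t) ∈ T from ⟨ht.1, hu.1, hu.2, ht.2⟩)]
      · rw [Set.indicator_of_notMem hu, hg, Set.indicator_of_notMem]
        exact fun h => hu ⟨h.2.1, h.2.2.1⟩
    · rw [Set.indicator_of_notMem ht]
      refine lintegral_eq_zero_of_ae_eq_zero (.of_forall fun u => ?_)
      exact Set.indicator_of_notMem (fun h => ht ⟨h.1, h.2.2.2⟩) _
  have hB := ProbabilityTheory.beta_pos hδ (sub_pos.2 hδ')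
  rw [hL, lintegral_lintegral_swap (f := fun u t => g (u, t)) hgm.aemeasurable, lintegral_congr hR,
    lintegral_indicator measurableSet_Ioo, lintegral_const_mul' _ _ ENNReal.ofReal_ne_top,
    lintegral_sub_rpow_mul_sub_rpow hp hδ hw, sub_zero, ENNReal.ofReal_mul hB.le]

theorem continuousOn_rieszKernel {p c w : ℝ} (hp : 0 < p) (hc : 0 < c) (hw : 0 ≤ w) :
    ContinuousOn (fun u => rieszKernel p c u w) (Set.Ioi 0 \ {w}) := by
  intro u hu
  have hu0 : 0 < u := hu.1
  have hwu : 0 < w + u := by linarith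
  have hz : 4 * u * w / (w + u) ^ 2 ∈ Set.Ioo (-1 : ℝ) 1 := by
    constructor
    · linarith [show 0 ≤ 4 * u * w / (w + u) ^ 2 by positivity]
    · rw [div_lt_one (by positivity)]
      nlinarith [sq_pos_of_ne_zero (sub_ne_zero.2 hu.2)]
  have hF := (analyticOnNhd_ordinaryHypergeometric (a := p / 2) (b := (p + 1) / 2)
    (by positivity) (by positivity) hc _ hz).continuousAt
  refine (ContinuousAt.mul ?_ ?_).continuousWithinAt
  · refine ContinuousAt.comp' (f := fun u : ℝ => 4 * u * w / (w + u) ^ 2) hF ?_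
    exact ContinuousAt.div (by fun_prop) (by fun_prop) (by positivity)
  · exact ContinuousAt.rpow_const (by fun_prop) (Or.inl hwu.ne')

/-- The potential of the density `u ^ (p + δ - 1) * (1 - u) ^ (-δ)` is constant on `[0, 1]`. At the
centre `w = 0` the kernel is `u ^ (-p)` and the integral is a beta integral. -/
theorem lintegral_rieszKernel {p δ w : ℝ} (hp : 0 < p) (hδ : 0 < δ) (hδ' : δ < 1)
    (hw : 0 ≤ w) (hw' : w ≤ 1) :
    ∫⁻ u in Set.Ioo (0 : ℝ) 1, ENNReal.ofReal
        (u ^ (p + δ - 1) * (1 - u) ^ (-δ) * rieszKernel p (p + δ) u w) =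
      ENNReal.ofReal (ProbabilityTheory.beta δ (1 - δ)) := by
  have hB := ProbabilityTheory.beta_pos hδ (sub_pos.2 hδ')
  rcases hw.eq_or_lt with rfl | hw0
  · rw [← lintegral_rpow_mul_one_sub_rpow hδ (sub_pos.2 hδ')]
    refine setLIntegral_congr_fun measurableSet_Ioo fun u hu => ?_
    have hu0 := hu.1
    simp only [rieszKernel, mul_zero, zero_div, ordinaryHypergeometric_zero, one_mul, zero_add]
    rw [mul_right_comm, ← Real.rpow_add hu0, show p + δ - 1 + -p = δ - 1 by ring,
      show 1 - δ - 1 = -δ by ring]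
  · have hBp := ProbabilityTheory.beta_pos hp hδ
    have hC : 0 < w ^ (p + δ - 1) * ProbabilityTheory.beta p δ := by positivity
    have hne : ∀ᵐ u ∂volume.restrict (Set.Ioo (0 : ℝ) 1), u ≠ w :=
      ae_restrict_of_ae (Measure.ae_ne volume w)
    have hC' : ENNReal.ofReal (w ^ (p + δ - 1) * ProbabilityTheory.beta p δ) ≠ 0 := by
      simpa using hC
    refine (ENNReal.mul_left_inj hC' ENNReal.ofReal_ne_top).1 ?_
    rw [← ENNReal.ofReal_mul hB.le, ← lintegral_lintegral_kernel hp hδ hδ' hw0 hw',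
      ← lintegral_mul_const' _ _ ENNReal.ofReal_ne_top]
    refine lintegral_congr_ae ?_
    filter_upwards [hne, ae_restrict_mem measurableSet_Ioo] with u huw hu
    have hu0 := hu.1
    have hu1 : 0 < 1 - u := sub_pos.2 hu.2
    have hK := rieszKernel_nonneg hp (add_pos hp hδ) hu0 hw huw
    rw [lintegral_kernel hp hδ hδ' hu0 hw0 huw, ← ENNReal.ofReal_mul (by positivity),
      ← ENNReal.ofReal_mul (by positivity), Real.mul_rpow hu0.le hw]
    congr 1
    ring

theorem integral_rieszKernel {p δ w : ℝ} (hp : 0 < p) (hδ : 0 < δ) (hδ' : δ < 1)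
    (hw : 0 ≤ w) (hw' : w ≤ 1) :
    IntegrableOn (fun u => u ^ (p + δ - 1) * (1 - u) ^ (-δ) * rieszKernel p (p + δ) u w)
        (Set.Ioo 0 1) ∧
      ∫ u in Set.Ioo (0 : ℝ) 1, u ^ (p + δ - 1) * (1 - u) ^ (-δ) * rieszKernel p (p + δ) u w =
        π / Real.sin (π * δ) := by
  have hc : 0 < p + δ := add_pos hp hδ
  rw [← beta_one_sub]
  refine integrable_and_integral_eq_of_lintegral_ofReal ?_ ?_
    (ProbabilityTheory.beta_pos hδ (sub_pos.2 hδ')).le (lintegral_rieszKernel hp hδ hδ' hw hw')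
  · filter_upwards [ae_restrict_of_ae (Measure.ae_ne volume w),
      ae_restrict_mem measurableSet_Ioo] with u huw hu
    have hu0 := hu.1
    have hu1 : 0 < 1 - u := sub_pos.2 hu.2
    have hK := rieszKernel_nonneg hp hc hu0 hw huw
    simp only [Pi.zero_apply]
    positivity
  · have hset : (Set.Ioo (0 : ℝ) 1 \ {w} : Set ℝ) =ᵐ[volume] Set.Ioo (0 : ℝ) 1 :=
      sdiff_null_ae_eq_self (measure_singleton w)
    rw [← Measure.restrict_congr_set hset]
    refine ContinuousOn.aestronglyMeasurable (fun u hu => ?_)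
      (measurableSet_Ioo.diff (measurableSet_singleton w))
    have hu1 : 1 - u ≠ 0 := (sub_pos.2 hu.1.2).ne'
    refine ContinuousWithinAt.mul (ContinuousAt.continuousWithinAt ?_)
      ((continuousOn_rieszKernel hp hc hw).mono (fun v hv => ⟨hv.1.1, hv.2⟩) u hu)
    exact (ContinuousAt.rpow_const (by fun_prop) (Or.inl hu.1.1.ne')).mul
      (ContinuousAt.rpow_const (by fun_prop) (Or.inl hu1))

/-! ### The variable `r` with `u = r ^ 2` -/

theorem image_sq_Ioo : (fun r : ℝ => r ^ 2) '' Set.Ioo 0 1 = Set.Ioo 0 1 := by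
  ext y
  constructor
  · rintro ⟨r, hr, rfl⟩
    exact ⟨pow_pos hr.1 2, pow_lt_one₀ hr.1.le hr.2 two_ne_zero⟩
  · intro hy
    exact ⟨√y, ⟨Real.sqrt_pos.2 hy.1, (Real.sqrt_lt' one_pos).2 (by simpa using hy.2)⟩,
      Real.sq_sqrt hy.1.le⟩

theorem corollary1p4 (d : ℕ) (hd : 2 ≤ d) (s : ℝ) (hs : (d : ℝ) - 2 < s) (hs' : s < d)
    (lam : ℝ) (hlam : lam ∈ Set.Icc (0 : ℝ) 1) :
    IntervalIntegrable
      (fun r : ℝ =>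
        (₂F₁ (s / 4) ((s + 2) / 4) ((d : ℝ) / 2)
            (4 * r ^ 2 * lam ^ 2 / (lam ^ 2 + r ^ 2) ^ 2) : ℝ) *
          (r ^ (d - 1) /
            ((lam ^ 2 + r ^ 2) ^ (s / 2) * (1 - r ^ 2) ^ (((d : ℝ) - s) / 2))))
      volume 0 1 ∧
    (∫ r in (0 : ℝ)..1,
        (₂F₁ (s / 4) ((s + 2) / 4) ((d : ℝ) / 2)
            (4 * r ^ 2 * lam ^ 2 / (lam ^ 2 + r ^ 2) ^ 2) : ℝ) *
          (r ^ (d - 1) /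
            ((lam ^ 2 + r ^ 2) ^ (s / 2) * (1 - r ^ 2) ^ (((d : ℝ) - s) / 2)))) =
      π / (2 * Real.sin (π / 2 * ((d : ℝ) - s))) := by
  have hd2 : (2 : ℝ) ≤ d := by exact_mod_cast hd
  set F : ℝ → ℝ := fun r =>
    (₂F₁ (s / 4) ((s + 2) / 4) ((d : ℝ) / 2)
        (4 * r ^ 2 * lam ^ 2 / (lam ^ 2 + r ^ 2) ^ 2) : ℝ) *
      (r ^ (d - 1) /
        ((lam ^ 2 + r ^ 2) ^ (s / 2) * (1 - r ^ 2) ^ (((d : ℝ) - s) / 2))) with hF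
  obtain ⟨hint, hval⟩ := integral_rieszKernel (p := s / 2) (δ := (d - s) / 2) (w := lam ^ 2)
    (by linarith) (by linarith) (by linarith) (sq_nonneg lam) (pow_le_one₀ hlam.1 hlam.2)
  set G : ℝ → ℝ := fun u => u ^ (s / 2 + (d - s) / 2 - 1) * (1 - u) ^ (-((d - s) / 2)) *
    rieszKernel (s / 2) (s / 2 + (d - s) / 2) u (lam ^ 2) with hG
  have hderiv : ∀ r ∈ Set.Ioo (0 : ℝ) 1,
      HasDerivWithinAt (fun r : ℝ => r ^ 2) (2 * r) (Set.Ioo 0 1) r := fun r _ => by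
    simpa using (hasDerivAt_pow 2 r).hasDerivWithinAt
  have hinj : Set.InjOn (fun r : ℝ => r ^ 2) (Set.Ioo 0 1) := fun r hr t ht h =>
    (pow_left_inj₀ hr.1.le ht.1.le two_ne_zero).1 h
  -- The integrand is half of the pullback of `G`, since `r ^ (d - 1) = (r ^ 2) ^ (d / 2 - 1) * r`.
  have hFG : Set.EqOn (fun r => |2 * r| • G (r ^ 2)) (fun r => 2 * F r) (Set.Ioo 0 1) := by
    intro r hr
    have hr0 := hr.1
    have hr1 : 0 < 1 - r ^ 2 := sub_pos.2 (pow_lt_one₀ hr0.le hr.2 two_ne_zero)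
    have hpow : (r ^ 2) ^ (s / 2 + (d - s) / 2 - 1) * r = r ^ (d - 1) := by
      rw [← Real.rpow_natCast r 2, ← Real.rpow_mul hr0.le, ← Real.rpow_add_one hr0.ne',
        ← Real.rpow_natCast r (d - 1), Nat.cast_sub (by omega)]
      congr 1
      push_cast
      ring
    simp only [hG, hF, smul_eq_mul, rieszKernel, abs_of_pos (mul_pos two_pos hr0)]
    rw [← hpow, Real.rpow_neg hr1.le, Real.rpow_neg (by positivity),
      show s / 2 / 2 = s / 4 by ring, show (s / 2 + 1) / 2 = (s + 2) / 4 by ring,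
      show s / 2 + (d - s) / 2 = (d : ℝ) / 2 by ring]
    field_simp
  have hint2 : IntegrableOn (fun r => 2 * F r) (Set.Ioo 0 1) := by
    rw [← integrableOn_congr_fun hFG measurableSet_Ioo,
      ← integrableOn_image_iff_integrableOn_abs_deriv_smul measurableSet_Ioo hderiv hinj,
      image_sq_Ioo]
    exact hint
  have hval2 : ∫ r in Set.Ioo (0 : ℝ) 1, 2 * F r = π / Real.sin (π * ((d - s) / 2)) := by
    rw [← setIntegral_congr_fun measurableSet_Ioo hFG,
      ← integral_image_eq_integral_abs_deriv_smul measurableSet_Ioo hderiv hinj, image_sq_Ioo,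
      hval]
  constructor
  · rw [intervalIntegrable_iff_integrableOn_Ioo_of_le zero_le_one]
    simpa [IntegrableOn] using hint2.const_mul (1 / 2)
  · rw [intervalIntegral.integral_of_le zero_le_one, integral_Ioc_eq_integral_Ioo]
    rw [integral_const_mul] at hval2
    rw [show π / 2 * ((d : ℝ) - s) = π * ((d - s) / 2) by ring, mul_comm 2 (Real.sin _), ← div_div,
      ← hval2]
    ring
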